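/- **Berry–Esseen theorem.** There is an absolute constant $C > 0$ such that the following holds. Let $n$ be a natural number and let $X_1, \dots, X_n$ be independent mean-zero real random variables (not necessarily identically distributed) whose sum $S_n := X_1 + \cdots + X_n$ satisfies $\operatorname{Var}(S_n) = 1$, and suppose that $\mathbb{E}|X_k|^3 < \infty$ for every $k$. Let $G$ be a standard normal random variable. Then $$\sup_{a \in \mathbb{R}} \bigl| \mathbb{P}\{S_n \le a\} - \mathbb{P}\{G \le a\} \bigr| \;\le\; C \sum_{k=1}^{n} \mathbb{E}|X_k|^3 .$$ -/

import Mathlib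

open MeasureTheory ProbabilityTheory

/-! Stein's method. Write S for the sum, Φ for `gaussCDF` and γ for the sum of the third absolute
moments. The bounded function f = `steinSol z` solves f'(w) - w f(w) = 1_{w ≤ z} - Φ(z), so P(S ≤ z)
- Φ(z) = E[f'(S) - S f(S)]. Since the X_k are independent and centred with variances σ_k² summing to
1, `integral_sum_mul_eq` turns this into the sum over k of σ_k² E f'(S) - E[X_k (f(S) - f(S -
X_k))].

Each term would be of third order in X_k if f' were smooth, but f' jumps at z. The jump matters only
when U = S - X_k lies within |X_k| of z (`abs_steinDeriv_sub_le`, `abs_steinSol_taylor_le`). As U is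
independent of X_k, `concentration_sum_le` bounds the chance of this, and the term is at most 18
E|X_k|³ + 20 γ σ_k² (`abs_stein_discrepancy_le`). Summing gives 38 γ. The concentration bound comes
from the same leave-one-out identity, with a truncated linear function in place of f. -/

/-! ### Gaussian tail, Mills ratio and distribution function. -/

/-- The unnormalized upper tail of the standard Gaussian density. -/
noncomputable def gaussTail (w : ℝ) : ℝ := ∫ x in Set.Ioi w, Real.exp (-x ^ 2 / 2)

theorem integrable_exp_neg_sq_half : Integrable fun x : ℝ => Real.exp (-x ^ 2 / 2) := by
  refine (integrable_exp_neg_mul_sq (b := 1 / 2) (by norm_num)).congr (.of_forall fun x => ?_)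
  simp only
  congr 1
  ring

theorem integral_exp_neg_sq_half : ∫ x : ℝ, Real.exp (-x ^ 2 / 2) = √(2 * Real.pi) := by
  rw [show 2 * Real.pi = Real.pi / (1 / 2) by ring, ← integral_gaussian (1 / 2)]
  refine integral_congr_ae (.of_forall fun x => ?_)
  simp only
  congr 1
  ring

theorem gaussTail_nonneg (w : ℝ) : 0 ≤ gaussTail w :=
  integral_nonneg fun _ => (Real.exp_pos _).le

theorem gaussTail_antitone : Antitone gaussTail := fun _ _ h =>
  setIntegral_mono_set integrable_exp_neg_sq_half.integrableOn
    (.of_forall fun _ => (Real.exp_pos _).le) (Set.Ioi_subset_Ioi h).eventuallyLE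

theorem gaussTail_neg (w : ℝ) : gaussTail (-w) = ∫ x in Set.Iic w, Real.exp (-x ^ 2 / 2) := by
  have := integral_comp_neg_Ioi (-w) fun x : ℝ => Real.exp (-x ^ 2 / 2)
  simpa [gaussTail] using this

theorem gaussTail_neg_add (w : ℝ) : gaussTail (-w) + gaussTail w = √(2 * Real.pi) := by
  rw [gaussTail_neg, gaussTail, ← integral_exp_neg_sq_half]
  exact intervalIntegral.integral_Iic_add_Ioi integrable_exp_neg_sq_half.integrableOn
    integrable_exp_neg_sq_half.integrableOn

theorem hasDerivAt_gaussTail (w : ℝ) :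
    HasDerivAt gaussTail (-Real.exp (-w ^ 2 / 2)) w := by
  have h : ∀ x, gaussTail x = gaussTail 0 - ∫ t in (0 : ℝ)..x, Real.exp (-t ^ 2 / 2) := fun x => by
    rw [← intervalIntegral.integral_Ioi_sub_Ioi' integrable_exp_neg_sq_half.integrableOn
      integrable_exp_neg_sq_half.integrableOn]
    simp [gaussTail]
  rw [show gaussTail = fun x => gaussTail 0 - ∫ t in (0 : ℝ)..x, Real.exp (-t ^ 2 / 2) from
    funext h]
  have hc : Continuous fun t : ℝ => Real.exp (-t ^ 2 / 2) := by fun_prop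
  exact (hc.integral_hasStrictDerivAt 0 w).hasDerivAt.const_sub _

/-- On the range of integration w ≤ x, and x exp(-x²/2) has the primitive -exp(-x²/2). The sign of w
plays no role. -/
theorem mul_gaussTail_le (w : ℝ) : w * gaussTail w ≤ Real.exp (-w ^ 2 / 2) := by
  have hd : ∀ x ∈ Set.Ici w, HasDerivAt (fun x : ℝ => -Real.exp (-x ^ 2 / 2))
      (x * Real.exp (-x ^ 2 / 2)) x := fun x _ => by
    have : HasDerivAt (fun x : ℝ => -x ^ 2 / 2) (-x) x := by
      refine ((hasDerivAt_pow 2 x).fun_neg.div_const 2).congr_deriv ?_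
      push_cast; ring
    refine this.exp.fun_neg.congr_deriv ?_
    ring
  have hi : Integrable fun x : ℝ => x * Real.exp (-x ^ 2 / 2) := by
    refine (integrable_mul_exp_neg_mul_sq (b := 1 / 2) (by norm_num)).congr
      (.of_forall fun x => ?_)
    simp only
    congr 2
    ring
  have ht : Filter.Tendsto (fun x : ℝ => -Real.exp (-x ^ 2 / 2)) Filter.atTop (nhds 0) := by
    rw [← neg_zero]
    refine (Real.tendsto_exp_atBot.comp ?_).neg
    have : Filter.Tendsto (fun x : ℝ => x ^ 2 / 2) Filter.atTop Filter.atTop :=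
      (Filter.tendsto_pow_atTop (by norm_num)).atTop_div_const (by norm_num)
    refine (Filter.tendsto_neg_atTop_atBot.comp this).congr fun x => ?_
    simp [neg_div]
  have h := integral_Ioi_of_hasDerivAt_of_tendsto' hd hi.integrableOn ht
  have h2 : w * gaussTail w ≤ ∫ x in Set.Ioi w, x * Real.exp (-x ^ 2 / 2) := by
    rw [gaussTail, ← integral_const_mul]
    refine setIntegral_mono_on (integrable_exp_neg_sq_half.const_mul w).integrableOn
      hi.integrableOn measurableSet_Ioi fun x hx => ?_
    exact mul_le_mul_of_nonneg_right (le_of_lt hx) (Real.exp_pos _).le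
  rw [h] at h2
  simpa using h2

/-- The Mills ratio of the standard Gaussian. -/
noncomputable def millsRatio (w : ℝ) : ℝ := Real.exp (w ^ 2 / 2) * gaussTail w

theorem millsRatio_nonneg (w : ℝ) : 0 ≤ millsRatio w :=
  mul_nonneg (Real.exp_pos _).le (gaussTail_nonneg w)

theorem mul_millsRatio_le_one (w : ℝ) : w * millsRatio w ≤ 1 := by
  have h := mul_le_mul_of_nonneg_left (mul_gaussTail_le w) (Real.exp_pos (w ^ 2 / 2)).le
  rw [← Real.exp_add, show w ^ 2 / 2 + -w ^ 2 / 2 = 0 by ring, Real.exp_zero] at h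
  calc w * millsRatio w = Real.exp (w ^ 2 / 2) * (w * gaussTail w) := by
        rw [millsRatio]; ring
    _ ≤ 1 := h

theorem hasDerivAt_millsRatio (w : ℝ) :
    HasDerivAt millsRatio (w * millsRatio w - 1) w := by
  have h : HasDerivAt (fun x : ℝ => x ^ 2 / 2) w w := by
    refine ((hasDerivAt_pow 2 w).div_const 2).congr_deriv ?_
    push_cast; ring
  have h2 := h.exp.mul (hasDerivAt_gaussTail w)
  have e : Real.exp (w ^ 2 / 2) * Real.exp (-w ^ 2 / 2) = 1 := by
    rw [← Real.exp_add, show w ^ 2 / 2 + -w ^ 2 / 2 = 0 by ring, Real.exp_zero]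
  refine h2.congr_deriv ?_
  rw [millsRatio]
  linear_combination -e

/-- The derivative w m(w) - 1 of the Mills ratio m is nonpositive, so the maximum on [0, ∞) is m(0)
= √(2π)/2. -/
theorem millsRatio_le_two {w : ℝ} (hw : 0 ≤ w) : millsRatio w ≤ 2 := by
  have ha : Antitone millsRatio := antitone_of_deriv_nonpos
    (fun w => (hasDerivAt_millsRatio w).differentiableAt) fun w => by
      rw [(hasDerivAt_millsRatio w).deriv]
      linarith [mul_millsRatio_le_one w]
  refine (ha hw).trans ?_
  have h0 := gaussTail_neg_add 0
  have h4 : √(2 * Real.pi) ≤ 4 := by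
    rw [Real.sqrt_le_left (by norm_num)]
    linarith [Real.pi_le_four]
  simp only [neg_zero] at h0
  simp only [millsRatio]
  norm_num
  linarith

/-- The standard Gaussian distribution function. -/
noncomputable def gaussCDF (z : ℝ) : ℝ := gaussTail (-z) / √(2 * Real.pi)

theorem sqrt_two_pi_pos : 0 < √(2 * Real.pi) := Real.sqrt_pos.2 (by positivity)

theorem gaussCDF_nonneg (z : ℝ) : 0 ≤ gaussCDF z :=
  div_nonneg (gaussTail_nonneg _) (Real.sqrt_nonneg _)

theorem one_sub_gaussCDF (z : ℝ) : 1 - gaussCDF z = gaussTail z / √(2 * Real.pi) := by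
  have := sqrt_two_pi_pos
  rw [gaussCDF, eq_div_iff this.ne', sub_mul, div_mul_cancel₀ _ this.ne', ← gaussTail_neg_add z]
  ring

theorem gaussCDF_le_one (z : ℝ) : gaussCDF z ≤ 1 := by
  have : 0 ≤ 1 - gaussCDF z := by
    rw [one_sub_gaussCDF]
    exact div_nonneg (gaussTail_nonneg _) (Real.sqrt_nonneg _)
  linarith

theorem gaussCDF_mono : Monotone gaussCDF := fun _ _ h =>
  div_le_div_of_nonneg_right (gaussTail_antitone (neg_le_neg h)) (Real.sqrt_nonneg _)

theorem gaussianReal_real_Iic (z : ℝ) : (gaussianReal 0 1).real (Set.Iic z) = gaussCDF z := by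
  rw [measureReal_def, gaussianReal_apply_eq_integral 0 one_ne_zero,
    ENNReal.toReal_ofReal (integral_nonneg fun x => gaussianPDFReal_nonneg _ _ _),
    gaussCDF, gaussTail_neg, div_eq_inv_mul, ← integral_const_mul]
  simp [gaussianPDFReal]

/-! ### Stein's equation for a half-line: bounds and regularity of the solution. -/

/-- The bounded solution of the Stein equation for the half-line `(-∞, z]`. -/
noncomputable def steinSol (z w : ℝ) : ℝ :=
  if w ≤ z then (1 - gaussCDF z) * millsRatio (-w) else gaussCDF z * millsRatio w

/-- The derivative of the Stein solution, as prescribed by the Stein equation. -/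
noncomputable def steinDeriv (z w : ℝ) : ℝ :=
  w * steinSol z w + (if w ≤ z then 1 else 0) - gaussCDF z

/-- Both sides are exp(w²/2) T(w) T(-w) / √(2π) with T = `gaussTail`. This glues the two branches of
`steinSol` at w = z. -/
theorem one_sub_gaussCDF_mul_millsRatio_neg (w : ℝ) :
    (1 - gaussCDF w) * millsRatio (-w) = gaussCDF w * millsRatio w := by
  rw [one_sub_gaussCDF, gaussCDF, millsRatio, millsRatio, neg_sq]
  ring

theorem steinSol_of_ge {z w : ℝ} (h : z ≤ w) : steinSol z w = gaussCDF z * millsRatio w := by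
  unfold steinSol
  split_ifs with h'
  · obtain rfl := le_antisymm h h'
    exact one_sub_gaussCDF_mul_millsRatio_neg _
  · rfl

theorem steinSol_nonneg (z w : ℝ) : 0 ≤ steinSol z w := by
  unfold steinSol
  split_ifs
  · exact mul_nonneg (by linarith [gaussCDF_le_one z]) (millsRatio_nonneg _)
  · exact mul_nonneg (gaussCDF_nonneg z) (millsRatio_nonneg _)

/-- The danger is a branch evaluating the Mills ratio at a negative argument, where it is unbounded.
There, monotonicity of Φ replaces z by w in the prefactor, and the gluing identity reflects the
argument to |w|. -/
theorem steinSol_le_millsRatio_abs (z w : ℝ) : steinSol z w ≤ millsRatio |w| := by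
  have key : ∀ p x : ℝ, p ≤ 1 → p * millsRatio x ≤ millsRatio x := fun p x hp =>
    mul_le_of_le_one_left (millsRatio_nonneg x) hp
  have c0 := gaussCDF_nonneg
  have c1 := gaussCDF_le_one
  unfold steinSol
  split_ifs with h
  · rcases le_total w 0 with hw | hw
    · rw [abs_of_nonpos hw]
      exact key _ _ (by linarith [c0 z])
    · rw [abs_of_nonneg hw]
      calc (1 - gaussCDF z) * millsRatio (-w) ≤ (1 - gaussCDF w) * millsRatio (-w) :=
            mul_le_mul_of_nonneg_right (by linarith [gaussCDF_mono h]) (millsRatio_nonneg _)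
        _ = gaussCDF w * millsRatio w := one_sub_gaussCDF_mul_millsRatio_neg w
        _ ≤ _ := key _ _ (c1 w)
  · rcases le_total w 0 with hw | hw
    · rw [abs_of_nonpos hw]
      calc gaussCDF z * millsRatio w ≤ gaussCDF w * millsRatio w :=
            mul_le_mul_of_nonneg_right (gaussCDF_mono (not_le.1 h).le) (millsRatio_nonneg _)
        _ = (1 - gaussCDF w) * millsRatio (-w) := (one_sub_gaussCDF_mul_millsRatio_neg w).symm
        _ ≤ _ := key _ _ (by linarith [c0 w])
    · rw [abs_of_nonneg hw]
      exact key _ _ (c1 z)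

theorem abs_steinSol_le_two (z w : ℝ) : |steinSol z w| ≤ 2 := by
  rw [abs_of_nonneg (steinSol_nonneg z w)]
  exact (steinSol_le_millsRatio_abs z w).trans (millsRatio_le_two (abs_nonneg w))

theorem abs_mul_steinSol_le_one (z w : ℝ) : |w * steinSol z w| ≤ 1 := by
  rw [abs_mul, abs_of_nonneg (steinSol_nonneg z w)]
  exact (mul_le_mul_of_nonneg_left (steinSol_le_millsRatio_abs z w) (abs_nonneg w)).trans
    (mul_millsRatio_le_one _)

theorem abs_steinDeriv_le_two (z w : ℝ) : |steinDeriv z w| ≤ 2 := by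
  have h := abs_le.1 (abs_mul_steinSol_le_one z w)
  have h0 := gaussCDF_nonneg z
  have h1 := gaussCDF_le_one z
  unfold steinDeriv
  split_ifs <;> rw [abs_le] <;> constructor <;> linarith

theorem hasDerivWithinAt_steinSol_Iic {z w : ℝ} (h : w ≤ z) :
    HasDerivWithinAt (steinSol z) (steinDeriv z w) (Set.Iic z) w := by
  have hd : HasDerivAt (fun w => (1 - gaussCDF z) * millsRatio (-w))
      ((1 - gaussCDF z) * ((-w * millsRatio (-w) - 1) * -1)) w :=
    ((hasDerivAt_millsRatio (-w)).comp w (hasDerivAt_neg w)).const_mul _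
  have e : steinDeriv z w = (1 - gaussCDF z) * ((-w * millsRatio (-w) - 1) * -1) := by
    rw [steinDeriv, steinSol, if_pos h, if_pos h]
    ring
  rw [e]
  exact hd.hasDerivWithinAt.congr (fun x hx => if_pos hx) (if_pos h)

/-- The inequality is strict because `steinDeriv z z` is the left derivative at the kink. -/
theorem hasDerivWithinAt_steinSol_Ici {z w : ℝ} (h : z < w) :
    HasDerivWithinAt (steinSol z) (steinDeriv z w) (Set.Ici z) w := by
  have hd : HasDerivAt (fun w => gaussCDF z * millsRatio w)
      (gaussCDF z * (w * millsRatio w - 1)) w := (hasDerivAt_millsRatio w).const_mul _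
  have e : steinDeriv z w = gaussCDF z * (w * millsRatio w - 1) := by
    rw [steinDeriv, steinSol, if_neg h.not_ge, if_neg h.not_ge]
    ring
  rw [e]
  exact hd.hasDerivWithinAt.congr (fun x hx => steinSol_of_ge hx) (steinSol_of_ge h.le)

theorem continuous_steinSol (z : ℝ) : Continuous (steinSol z) := by
  have hm : Continuous millsRatio :=
    continuous_iff_continuousAt.2 fun w => (hasDerivAt_millsRatio w).continuousAt
  refine Continuous.if_le ?_ ?_ continuous_id continuous_const fun x hx => ?_
  · fun_prop
  · fun_prop
  · obtain rfl : x = z := hx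
    exact one_sub_gaussCDF_mul_millsRatio_neg _

theorem hasDerivAt_steinSol {z w : ℝ} (h : w ≠ z) :
    HasDerivAt (steinSol z) (steinDeriv z w) w := by
  rcases h.lt_or_gt with h | h
  · exact (hasDerivWithinAt_steinSol_Iic h.le).hasDerivAt (Iic_mem_nhds h)
  · exact (hasDerivWithinAt_steinSol_Ici h).hasDerivAt (Ici_mem_nhds h)

theorem steinSol_lipschitz_of_interior {z x y : ℝ} (hxy : x ≤ y) (hz : z ∉ Set.Ioo x y) :
    |steinSol z y - steinSol z x| ≤ 2 * (y - x) := by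
  rcases hxy.eq_or_lt with rfl | hlt
  · simp
  obtain ⟨c, hc, hce⟩ := exists_hasDerivAt_eq_slope (steinSol z) (steinDeriv z) hlt
    (continuous_steinSol z).continuousOn fun t ht =>
      hasDerivAt_steinSol fun h => hz (h ▸ ht)
  have hp : 0 < y - x := sub_pos.2 hlt
  rw [eq_div_iff hp.ne'] at hce
  rw [← hce, abs_mul, abs_of_pos hp]
  exact mul_le_mul_of_nonneg_right (abs_steinDeriv_le_two z c) hp.le

theorem abs_steinSol_sub_le (z x y : ℝ) : |steinSol z y - steinSol z x| ≤ 2 * |y - x| := by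
  wlog hxy : x ≤ y generalizing x y
  · rw [abs_sub_comm, abs_sub_comm y]
    exact this y x (le_of_not_ge hxy)
  rw [abs_of_nonneg (sub_nonneg.2 hxy)]
  by_cases hz : z ∈ Set.Ioo x y
  · have h1 := steinSol_lipschitz_of_interior (z := z) hz.1.le (by simp)
    have h2 := steinSol_lipschitz_of_interior (z := z) hz.2.le (by simp)
    have h3 := abs_sub_le (steinSol z y) (steinSol z z) (steinSol z x)
    linarith
  · exact steinSol_lipschitz_of_interior hxy hz

theorem abs_mul_steinSol_sub_le (z w t : ℝ) :
    |t * steinSol z t - w * steinSol z w| ≤ (2 * |w| + 2) * |t - w| := by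
  have e : t * steinSol z t - w * steinSol z w
      = w * (steinSol z t - steinSol z w) + steinSol z t * (t - w) := by ring
  rw [e]
  refine (abs_add_le _ _).trans ?_
  rw [abs_mul, abs_mul]
  have h1 := mul_le_mul_of_nonneg_left (abs_steinSol_sub_le z w t) (abs_nonneg w)
  have h2 := mul_le_mul_of_nonneg_right (abs_steinSol_le_two z t) (abs_nonneg (t - w))
  linarith

theorem same_side_of_abs_lt {z w t : ℝ} (h : |t - w| < |w - z|) : t ≤ z ↔ w ≤ z := by
  rw [abs_lt] at h
  rcases le_total w z with hw | hw
  · rw [abs_of_nonpos (by linarith)] at h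
    exact ⟨fun _ => hw, fun _ => by linarith⟩
  · rw [abs_of_nonneg (by linarith)] at h
    exact ⟨fun _ => by linarith, fun _ => by linarith⟩

theorem abs_steinDeriv_sub_le (z w s : ℝ) :
    |steinDeriv z (w + s) - steinDeriv z w| ≤
      (2 * |w| + 2) * |s| + (if |w - z| ≤ |s| then 1 else 0) := by
  have h := abs_mul_steinSol_sub_le z w (w + s)
  rw [add_sub_cancel_left] at h
  have e : steinDeriv z (w + s) - steinDeriv z w
      = ((w + s) * steinSol z (w + s) - w * steinSol z w)
        + ((if w + s ≤ z then 1 else 0) - (if w ≤ z then 1 else 0)) := by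
    unfold steinDeriv; ring
  rw [e]
  refine (abs_add_le _ _).trans (add_le_add h ?_)
  split_ifs with h1 h2 h3 h3 h2 h3 h3 <;> norm_num
  all_goals
    have := same_side_of_abs_lt (z := z) (w := w) (t := w + s)
      (by rw [add_sub_cancel_left]; exact not_le.1 h3)
    tauto

/-- If z may lie between w and w + s, the Lipschitz bound and the bound on f' cost 2|s| each.
Otherwise the indicator is constant on the segment, so f' varies there only through w f(w). -/
theorem abs_steinSol_taylor_le (z w s : ℝ) :
    |steinSol z (w + s) - steinSol z w - s * steinDeriv z w| ≤
      (2 * |w| + 2) * s ^ 2 + 4 * |s| * (if |w - z| ≤ |s| then 1 else 0) := by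
  split_ifs with h
  · have h1 := abs_steinSol_sub_le z w (w + s)
    rw [add_sub_cancel_left] at h1
    have h2 := mul_le_mul_of_nonneg_left (abs_steinDeriv_le_two z w) (abs_nonneg s)
    rw [← abs_mul] at h2
    have h3 := abs_sub (steinSol z (w + s) - steinSol z w) (s * steinDeriv z w)
    have h4 : 0 ≤ (2 * |w| + 2) * s ^ 2 := by positivity
    linarith
  · rw [not_le] at h
    have hside : ∀ t ∈ segment ℝ w (w + s), |t - w| < |w - z| := fun t ht => by
      rw [segment_eq_uIcc] at ht
      have := Set.abs_sub_left_of_mem_uIcc ht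
      rw [add_sub_cancel_left] at this
      exact this.trans_lt h
    have hne : ∀ t ∈ segment ℝ w (w + s), t ≠ z := fun t ht h' => by
      have := hside t ht
      rw [h', abs_sub_comm] at this
      exact lt_irrefl _ this
    -- Subtracting the linear term makes the derivative f'(t) - f'(w), ready for the mean value
    -- inequality.
    have hd : ∀ t ∈ segment ℝ w (w + s), HasDerivWithinAt
        (fun t => steinSol z t - t * steinDeriv z w)
        (steinDeriv z t - 1 * steinDeriv z w) (segment ℝ w (w + s)) t := fun t ht =>
      ((hasDerivAt_steinSol (hne t ht)).sub
        ((hasDerivAt_id t).mul_const _)).hasDerivWithinAt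
    have hb : ∀ t ∈ segment ℝ w (w + s),
        ‖steinDeriv z t - 1 * steinDeriv z w‖ ≤ (2 * |w| + 2) * |s| := fun t ht => by
      have hs := same_side_of_abs_lt (hside t ht)
      have e : steinDeriv z t - 1 * steinDeriv z w
          = t * steinSol z t - w * steinSol z w := by
        unfold steinDeriv
        rw [if_congr hs rfl rfl]
        ring
      rw [e, Real.norm_eq_abs]
      refine (abs_mul_steinSol_sub_le z w t).trans ?_
      rw [segment_eq_uIcc] at ht
      have := Set.abs_sub_left_of_mem_uIcc ht
      rw [add_sub_cancel_left] at this
      gcongr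
    have := (convex_segment w (w + s)).norm_image_sub_le_of_norm_hasDerivWithin_le hd hb
      (left_mem_segment ℝ _ _) (right_mem_segment ℝ _ _)
    rw [Real.norm_eq_abs, Real.norm_eq_abs, add_sub_cancel_left, mul_assoc, abs_mul_abs_self] at this
    calc _ = |steinSol z (w + s) - (w + s) * steinDeriv z w
            - (steinSol z w - w * steinDeriv z w)| := by congr 1; ring
      _ ≤ _ := by linarith [this, sq s]

theorem measurable_steinSol (z : ℝ) : Measurable (steinSol z) := (continuous_steinSol z).measurable

theorem measurable_steinDeriv (z : ℝ) : Measurable (steinDeriv z) :=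
  ((measurable_id.mul (measurable_steinSol z)).add
    (Measurable.ite measurableSet_Iic measurable_const measurable_const)).sub measurable_const

/-! ### Moment inequalities and second moments of independent sums. -/

section Moments

variable {Ω ι : Type*} [MeasurableSpace Ω] {P : Measure Ω}

theorem memLp_three_of_integrable {Y : Ω → ℝ} (hm : Measurable Y)
    (h : Integrable (fun ω => |Y ω| ^ 3) P) : MemLp Y 3 P := by
  refine (integrable_norm_rpow_iff hm.aestronglyMeasurable (by norm_num) (by norm_num)).1 ?_
  refine h.congr (.of_forall fun ω => ?_)
  simp [Real.norm_eq_abs]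

theorem memLp_two_of_integrable [IsProbabilityMeasure P] {Y : Ω → ℝ} (hm : Measurable Y)
    (h : Integrable (fun ω => |Y ω| ^ 3) P) : MemLp Y 2 P :=
  (memLp_three_of_integrable hm h).mono_exponent (by norm_num)

/-- Integrate the pointwise AM-GM bound |Y| ≤ Y²/(2c) + c/2. -/
theorem integral_abs_le_of_integral_sq_le [IsProbabilityMeasure P] {Y : Ω → ℝ}
    (hY : MemLp Y 2 P) {c : ℝ} (hc : 0 < c) (h : ∫ ω, Y ω ^ 2 ∂P ≤ c ^ 2) : ∫ ω, |Y ω| ∂P ≤ c := by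
  have h1 : ∫ ω, |Y ω| ∂P ≤ ∫ ω, (Y ω ^ 2 / (2 * c) + c / 2) ∂P := by
    refine integral_mono (hY.integrable (by norm_num)).abs
      ((hY.integrable_sq.div_const _).add (integrable_const _)) fun ω => ?_
    have := sq_nonneg (|Y ω| - c)
    simp only
    rw [← sq_abs (Y ω), ← sub_nonneg]
    have e : |Y ω| ^ 2 / (2 * c) + c / 2 - |Y ω| = (|Y ω| - c) ^ 2 / (2 * c) := by
      field_simp; ring
    rw [e]
    positivity
  rw [integral_add (hY.integrable_sq.div_const _) (integrable_const _), integral_div] at h1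
  simp only [integral_const, probReal_univ, smul_eq_mul, one_mul] at h1
  have h2 : (∫ ω, Y ω ^ 2 ∂P) / (2 * c) ≤ c / 2 := by
    rw [div_le_iff₀ (by positivity)]
    linarith
  linarith

/-- Lyapunov's inequality, from 2y³ - 3uy² + u³ = (2y + u)(y - u)² ≥ 0 at y = |Y|, integrated with
u² = E Y². -/
theorem sqrt_integral_sq_pow_three_le [IsProbabilityMeasure P] {Y : Ω → ℝ} (hm : Measurable Y)
    (h : Integrable (fun ω => |Y ω| ^ 3) P) :
    √(∫ ω, Y ω ^ 2 ∂P) ^ 3 ≤ ∫ ω, |Y ω| ^ 3 ∂P := by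
  set u := √(∫ ω, Y ω ^ 2 ∂P) with hu
  have hu0 : 0 ≤ u := Real.sqrt_nonneg _
  have hu2 : u ^ 2 = ∫ ω, Y ω ^ 2 ∂P := Real.sq_sqrt (integral_nonneg fun ω => sq_nonneg _)
  have hY := memLp_two_of_integrable hm h
  have h1 : ∫ ω, (3 * u * Y ω ^ 2 - u ^ 3) ∂P ≤ ∫ ω, 2 * |Y ω| ^ 3 ∂P := by
    refine integral_mono ((hY.integrable_sq.const_mul _).sub (integrable_const _))
      (h.const_mul 2) fun ω => ?_
    simp only
    rw [← sq_abs (Y ω)]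
    nlinarith [mul_nonneg (add_nonneg (mul_nonneg zero_le_two (abs_nonneg (Y ω))) hu0)
      (sq_nonneg (|Y ω| - u))]
  rw [integral_sub (hY.integrable_sq.const_mul _) (integrable_const _), integral_const_mul,
    integral_const_mul, ← hu2] at h1
  simp only [integral_const, probReal_univ, smul_eq_mul, one_mul] at h1
  nlinarith

theorem integral_sq_mul_integral_abs_le [IsProbabilityMeasure P] {Y : Ω → ℝ} (hm : Measurable Y)
    (h : Integrable (fun ω => |Y ω| ^ 3) P) :
    (∫ ω, Y ω ^ 2 ∂P) * ∫ ω, |Y ω| ∂P ≤ ∫ ω, |Y ω| ^ 3 ∂P := by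
  have h3 := sqrt_integral_sq_pow_three_le hm h
  set u := √(∫ ω, Y ω ^ 2 ∂P) with hu
  have hu0 : 0 ≤ u := Real.sqrt_nonneg _
  have hu2 : u ^ 2 = ∫ ω, Y ω ^ 2 ∂P := Real.sq_sqrt (integral_nonneg fun ω => sq_nonneg _)
  rcases hu0.eq_or_lt with h0 | h0
  · rw [← hu2, ← h0]
    simpa using integral_nonneg fun ω => by positivity
  · have := integral_abs_le_of_integral_sq_le (memLp_two_of_integrable hm h) h0 hu2.ge
    rw [← hu2]
    calc u ^ 2 * ∫ ω, |Y ω| ∂P ≤ u ^ 2 * u := by gcongr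
      _ = u ^ 3 := by ring
      _ ≤ _ := h3

theorem variance_finset_sum_eq {X : ι → Ω → ℝ} (hi : iIndepFun X P) (s : Finset ι)
    (h2 : ∀ k, MemLp (X k) 2 P) (h0 : ∀ k, ∫ ω, X k ω ∂P = 0) :
    variance (fun ω => ∑ j ∈ s, X j ω) P = ∑ j ∈ s, ∫ ω, X j ω ^ 2 ∂P := by
  have e : (fun ω => ∑ j ∈ s, X j ω) = ∑ j ∈ s, X j := by
    ext ω; simp
  rw [e, IndepFun.variance_sum (fun i _ => h2 i) fun i _ j _ hij => hi.indepFun hij]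
  refine Finset.sum_congr rfl fun j _ => ?_
  exact variance_of_integral_eq_zero (h2 j).aestronglyMeasurable.aemeasurable (h0 j)

theorem integral_finset_sum_sq_eq [IsProbabilityMeasure P] {X : ι → Ω → ℝ}
    (hi : iIndepFun X P) (s : Finset ι) (h2 : ∀ k, MemLp (X k) 2 P)
    (h0 : ∀ k, ∫ ω, X k ω ∂P = 0) :
    ∫ ω, (∑ j ∈ s, X j ω) ^ 2 ∂P = ∑ j ∈ s, ∫ ω, X j ω ^ 2 ∂P := by
  rw [← variance_finset_sum_eq hi s h2 h0]
  refine (variance_of_integral_eq_zero ?_ ?_).symm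
  · exact (memLp_finsetSum s fun j _ => h2 j).aestronglyMeasurable.aemeasurable
  · rw [integral_finsetSum _ fun j _ => (h2 j).integrable (by norm_num)]
    simp [h0]

theorem indepFun_sum_erase [DecidableEq ι] {X : ι → Ω → ℝ} (hX : ∀ k, Measurable (X k))
    (hi : iIndepFun X P) (s : Finset ι) (k : ι) :
    IndepFun (fun ω => ∑ j ∈ s.erase k, X j ω) (X k) P := by
  have := hi.indepFun_finsetSum_of_notMem hX (Finset.notMem_erase k s)
  convert this using 1
  ext ω; simp

end Moments

/-! ### Truncated linear test functions. -/

/-- The identity centred at `m` and truncated at height `c`. -/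
noncomputable def clip (m c w : ℝ) : ℝ := max (-c) (min c (w - m))

theorem measurable_clip (m c : ℝ) : Measurable (clip m c) :=
  measurable_const.max (measurable_const.min (measurable_id.sub_const m))

theorem clip_mono (m c : ℝ) : Monotone (clip m c) := fun x y h => by
  unfold clip; gcongr

theorem abs_clip_le {m c : ℝ} (hc : 0 ≤ c) (w : ℝ) : |clip m c w| ≤ c := by
  unfold clip
  rw [abs_le]
  exact ⟨le_max_left _ _, max_le (by linarith) (min_le_left _ _)⟩

theorem mul_clip_sub_nonneg (m c w x : ℝ) : 0 ≤ x * (clip m c w - clip m c (w - x)) := by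
  rcases le_total 0 x with hx | hx
  · exact mul_nonneg hx (sub_nonneg.2 (clip_mono m c (by linarith)))
  · exact mul_nonneg_of_nonpos_of_nonpos hx (sub_nonpos.2 (clip_mono m c (by linarith)))

/-- The margin δ on both sides of [a, b] lets the clipped function follow a step from w in either
direction with slope 1 for a length at least δ. -/
theorem abs_mul_min_le_mul_clip_sub {a b δ w : ℝ} (hδ : 0 ≤ δ) (ha : a ≤ w) (hb : w ≤ b) (x : ℝ) :
    |x| * min δ |x| ≤
      x * (clip ((a + b) / 2) ((b - a) / 2 + δ) w
        - clip ((a + b) / 2) ((b - a) / 2 + δ) (w - x)) := by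
  have hw : clip ((a + b) / 2) ((b - a) / 2 + δ) w = w - (a + b) / 2 := by
    unfold clip
    rw [min_eq_right (by linarith), max_eq_right (by linarith)]
  rw [hw]
  rcases le_total 0 x with hx | hx
  · rw [abs_of_nonneg hx]
    refine mul_le_mul_of_nonneg_left ?_ hx
    unfold clip
    rw [min_eq_right (by linarith : w - x - (a + b) / 2 ≤ (b - a) / 2 + δ)]
    rcases min_cases δ x with h | h <;>
      rcases max_cases (-((b - a) / 2 + δ)) (w - x - (a + b) / 2) with h' | h' <;> linarith
  · rw [abs_of_nonpos hx, neg_mul, ← mul_neg]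
    refine mul_le_mul_of_nonpos_left ?_ hx
    unfold clip
    rw [max_eq_right (le_min (by linarith) (by linarith))]
    rcases min_cases δ (-x) with h | h <;>
      rcases min_cases ((b - a) / 2 + δ) (w - x - (a + b) / 2) with h' | h' <;> linarith

/-- Both bounds on the minimum are elementary; the one by δ is (|x| - 2δ)² ≥ 0. -/
theorem sub_le_abs_mul_min {δ : ℝ} (hδ : 0 < δ) (x : ℝ) :
    x ^ 2 - |x| ^ 3 / (4 * δ) ≤ |x| * min δ |x| := by
  rw [← sq_abs]
  have e : |x| ^ 2 - |x| ^ 3 / (4 * δ) = |x| * (|x| - |x| ^ 2 / (4 * δ)) := by ring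
  rw [e]
  refine mul_le_mul_of_nonneg_left (le_min ?_ ?_) (abs_nonneg x)
  · have : δ - (|x| - |x| ^ 2 / (4 * δ)) = (|x| - 2 * δ) ^ 2 / (4 * δ) := by
      field_simp; ring
    have h2 : 0 ≤ (|x| - 2 * δ) ^ 2 / (4 * δ) := by positivity
    linarith
  · have : 0 ≤ |x| ^ 2 / (4 * δ) := by positivity
    linarith

/-! ### Leave-one-out identity and concentration inequality. -/

section Concentration

variable {Ω ι : Type*} [MeasurableSpace Ω] {P : Measure Ω} [IsProbabilityMeasure P] [DecidableEq ι]

/-- Leave-one-out formula for `E[S φ(S)]`, where `S` is a sum of independent centred variables and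
`φ` is bounded and measurable. -/
theorem integral_sum_mul_eq {X : ι → Ω → ℝ} (hX : ∀ k, Measurable (X k)) (hi : iIndepFun X P)
    (h2 : ∀ k, MemLp (X k) 2 P) (h0 : ∀ k, ∫ ω, X k ω ∂P = 0) (s : Finset ι)
    {φ : ℝ → ℝ} (hφ : Measurable φ) {c : ℝ} (hc : ∀ w, |φ w| ≤ c) :
    ∫ ω, (∑ j ∈ s, X j ω) * φ (∑ j ∈ s, X j ω) ∂P
      = ∑ k ∈ s, ∫ ω, X k ω *
          (φ (∑ j ∈ s, X j ω) - φ (∑ j ∈ s, X j ω - X k ω)) ∂P := by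
  have hint : ∀ k, ∀ t : Ω → ℝ, Measurable t → Integrable (fun ω => X k ω * φ (t ω)) P :=
    fun k t ht => ((h2 k).integrable (by norm_num)).mul_bdd (c := c)
      (hφ.comp ht).aestronglyMeasurable (.of_forall fun ω => hc _)
  have hS : Measurable fun ω => ∑ j ∈ s, X j ω := Finset.measurable_fun_sum s fun j _ => hX j
  simp only [Finset.sum_mul]
  rw [integral_finsetSum _ fun k _ => hint k _ hS]
  refine Finset.sum_congr rfl fun k hk => ?_
  simp only [mul_sub]
  rw [integral_sub (hint k _ hS) (hint k (fun ω => ∑ j ∈ s, X j ω - X k ω) (hS.sub (hX k)))]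
  -- The sum without X_k is independent of X_k, which is centred.
  have hz : ∫ ω, X k ω * φ (∑ j ∈ s, X j ω - X k ω) ∂P = 0 := by
    have e : ∀ ω, ∑ j ∈ s, X j ω - X k ω = ∑ j ∈ s.erase k, X j ω := fun ω => by
      rw [← Finset.add_sum_erase s (fun j => X j ω) hk]; ring
    simp only [e]
    have hind := ((indepFun_sum_erase hX hi s k).comp hφ measurable_id).symm
    have hm : Measurable fun ω => ∑ j ∈ s.erase k, X j ω :=
      Finset.measurable_fun_sum _ fun j _ => hX j
    have := hind.integral_fun_mul_eq_mul_integral (hX k).aestronglyMeasurable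
      (hφ.comp hm).aestronglyMeasurable
    simp only [Function.comp_def, id] at this
    rw [this, h0 k, zero_mul]
  rw [hz, sub_zero]

/-- A concentration inequality for a sum of independent random variables whose variance is
bounded away from zero. -/
theorem concentration_sum_le {X : ι → Ω → ℝ} (hX : ∀ k, Measurable (X k)) (hi : iIndepFun X P)
    (h3 : ∀ k, Integrable (fun ω => |X k ω| ^ 3) P) (h0 : ∀ k, ∫ ω, X k ω ∂P = 0)
    (s : Finset ι) {γ : ℝ} (hγ : 0 < γ) (hs3 : ∑ j ∈ s, ∫ ω, |X j ω| ^ 3 ∂P ≤ γ)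
    (hV1 : ∑ j ∈ s, ∫ ω, X j ω ^ 2 ∂P ≤ 1) (hV : 3 / 4 ≤ ∑ j ∈ s, ∫ ω, X j ω ^ 2 ∂P)
    {a b : ℝ} (hab : a ≤ b) :
    P.real {ω | ∑ j ∈ s, X j ω ∈ Set.Icc a b} ≤ (b - a) + 4 * γ := by
  have h2 : ∀ k, MemLp (X k) 2 P := fun k => memLp_two_of_integrable (hX k) (h3 k)
  have hS : Measurable fun ω => ∑ j ∈ s, X j ω := Finset.measurable_fun_sum s fun j _ => hX j
  have hS2 : MemLp (fun ω => ∑ j ∈ s, X j ω) 2 P := memLp_finsetSum s fun j _ => h2 j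
  set A : Set Ω := {ω | ∑ j ∈ s, X j ω ∈ Set.Icc a b} with hA
  have hAm : MeasurableSet A := hS measurableSet_Icc
  -- Half the length of [a, b] plus the margin δ = γ.
  set c := (b - a) / 2 + γ with hcdef
  have hc : 0 ≤ c := by rw [hcdef]; linarith
  set φ := clip ((a + b) / 2) c with hφdef
  have hφ : Measurable φ := measurable_clip _ _
  have hφc : ∀ w, |φ w| ≤ c := abs_clip_le hc
  let g : ℝ → ℝ := fun x => |x| * min γ |x|
  have hg : Measurable g := by
    have h1 : Measurable fun x : ℝ => |x| := continuous_abs.measurable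
    exact h1.mul (measurable_const.min h1)
  have hg0 : ∀ x, 0 ≤ g x := fun x =>
    mul_nonneg (abs_nonneg x) (le_min hγ.le (abs_nonneg x))
  have hgle : ∀ x, g x ≤ γ * |x| := fun x => by
    rw [mul_comm γ]
    exact mul_le_mul_of_nonneg_left (min_le_left _ _) (abs_nonneg x)
  have hη2 : ∀ k, MemLp (fun ω => g (X k ω)) 2 P := fun k => by
    refine ((h2 k).const_mul γ).mono (hg.comp (hX k)).aestronglyMeasurable (.of_forall fun ω => ?_)
    rw [Real.norm_eq_abs, Real.norm_eq_abs, abs_of_nonneg (hg0 _), abs_mul, abs_of_pos hγ]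
    exact hgle _
  set H : Ω → ℝ := fun ω => ∑ k ∈ s, g (X k ω) with hH
  have hH2 : MemLp H 2 P := memLp_finsetSum s fun k _ => hη2 k
  have hHi : Integrable H P := hH2.integrable (by norm_num)
  have hupper : ∫ ω, (∑ j ∈ s, X j ω) * φ (∑ j ∈ s, X j ω) ∂P ≤ c := by
    have h1 : ∫ ω, |∑ j ∈ s, X j ω| ∂P ≤ 1 :=
      integral_abs_le_of_integral_sq_le hS2 one_pos (by
        rw [integral_finset_sum_sq_eq hi s h2 h0]; simpa using hV1)
    calc _ ≤ ∫ ω, |∑ j ∈ s, X j ω| * c ∂P := by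
          refine integral_mono ((hS2.integrable (by norm_num)).mul_bdd (c := c)
            (hφ.comp hS).aestronglyMeasurable (.of_forall fun ω => hφc _))
            ((hS2.integrable (by norm_num)).abs.mul_const c) fun ω => ?_
          refine (le_abs_self _).trans ?_
          rw [abs_mul]
          exact mul_le_mul_of_nonneg_left (hφc _) (abs_nonneg _)
      _ = (∫ ω, |∑ j ∈ s, X j ω| ∂P) * c := integral_mul_const _ _
      _ ≤ 1 * c := mul_le_mul_of_nonneg_right h1 hc
      _ = c := one_mul c
  -- On A each leave-one-out increment dominates g(X_k); off A it is nonnegative by monotonicity of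
  -- the clip.
  have hlower : ∫ ω in A, H ω ∂P ≤ ∫ ω, (∑ j ∈ s, X j ω) * φ (∑ j ∈ s, X j ω) ∂P := by
    rw [integral_sum_mul_eq hX hi h2 h0 s hφ hφc]
    rw [integral_finsetSum s fun k _ => ((hη2 k).integrable (by norm_num)).integrableOn]
    refine Finset.sum_le_sum fun k _ => ?_
    rw [← integral_indicator hAm]
    have hint : Integrable (fun ω => X k ω *
        (φ (∑ j ∈ s, X j ω) - φ (∑ j ∈ s, X j ω - X k ω))) P := by
      refine ((h2 k).integrable (by norm_num)).mul_bdd (c := c + c)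
        ((hφ.comp hS).sub (hφ.comp (hS.sub (hX k)))).aestronglyMeasurable (.of_forall fun ω => ?_)
      exact (norm_sub_le _ _).trans (add_le_add (hφc _) (hφc _))
    refine integral_mono (((hη2 k).integrable (by norm_num)).indicator hAm) hint fun ω => ?_
    simp only [Set.indicator]
    split_ifs with hω
    · exact abs_mul_min_le_mul_clip_sub hγ.le hω.1 hω.2 _
    · exact mul_clip_sub_nonneg _ _ _ _
  -- Variance at least 3/4, minus γ/(4γ) = 1/4.
  have hEH : 1 / 2 ≤ ∫ ω, H ω ∂P := by
    have h1 : ∑ k ∈ s, (∫ ω, X k ω ^ 2 ∂P - (∫ ω, |X k ω| ^ 3 ∂P) / (4 * γ)) ≤ ∫ ω, H ω ∂P := by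
      rw [integral_finsetSum s fun k _ => (hη2 k).integrable (by norm_num)]
      refine Finset.sum_le_sum fun k _ => ?_
      rw [← integral_div, ← integral_sub (h2 k).integrable_sq ((h3 k).div_const _)]
      exact integral_mono ((h2 k).integrable_sq.sub ((h3 k).div_const _))
        ((hη2 k).integrable (by norm_num)) fun ω => sub_le_abs_mul_min hγ _
    rw [Finset.sum_sub_distrib, ← Finset.sum_div] at h1
    have h4 : (∑ k ∈ s, ∫ ω, |X k ω| ^ 3 ∂P) / (4 * γ) ≤ 1 / 4 := by
      rw [div_le_iff₀ (by positivity)]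
      linarith
    linarith
  -- H is a sum of independent terms with g(x) ≤ γ|x|, so its fluctuation around its mean costs at
  -- most γ, even when restricted to A.
  have hvar : variance H P ≤ γ ^ 2 := by
    have e : H = ∑ k ∈ s, fun ω => g (X k ω) := by ext ω; simp [hH]
    rw [e, IndepFun.variance_sum (fun k _ => hη2 k)
      fun k _ j _ hkj => (hi.indepFun hkj).comp hg hg]
    calc _ ≤ ∑ k ∈ s, γ ^ 2 * ∫ ω, X k ω ^ 2 ∂P := by
          refine Finset.sum_le_sum fun k _ => ?_
          refine (variance_le_expectation_sq (hg.comp (hX k)).aestronglyMeasurable).trans ?_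
          rw [← integral_const_mul]
          refine integral_mono (hη2 k).integrable_sq ((h2 k).integrable_sq.const_mul _) fun ω => ?_
          have := pow_le_pow_left₀ (hg0 (X k ω)) (hgle (X k ω)) 2
          rwa [mul_pow γ, sq_abs] at this
      _ = γ ^ 2 * ∑ k ∈ s, ∫ ω, X k ω ^ 2 ∂P := (Finset.mul_sum _ _ _).symm
      _ ≤ γ ^ 2 := mul_le_of_le_one_right (by positivity) hV1
  set μ := ∫ ω, H ω ∂P with hμ
  have hdev : ∫ ω, |H ω - μ| ∂P ≤ γ := by
    refine integral_abs_le_of_integral_sq_le (hH2.sub (memLp_const μ)) hγ ?_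
    rwa [variance_eq_integral hH2.aestronglyMeasurable.aemeasurable] at hvar
  have hAH : P.real A * μ - γ ≤ ∫ ω in A, H ω ∂P := by
    have h1 : ∫ ω in A, (μ - H ω) ∂P ≤ γ := by
      have hdi : Integrable (fun ω => |H ω - μ|) P := (hHi.sub (integrable_const μ)).abs
      calc _ ≤ ∫ ω in A, |H ω - μ| ∂P := by
            refine integral_mono ((integrable_const μ).sub hHi).integrableOn hdi.integrableOn
              fun ω => ?_
            simp only
            rw [abs_sub_comm]
            exact le_abs_self _
        _ ≤ ∫ ω, |H ω - μ| ∂P := setIntegral_le_integral hdi (.of_forall fun ω => abs_nonneg _)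
        _ ≤ γ := hdev
    rw [integral_sub (integrable_const μ) hHi.integrableOn, setIntegral_const, smul_eq_mul] at h1
    linarith
  -- Altogether P(A)/2 - γ ≤ c, which is the claim.
  have hP : P.real A * (1 / 2) ≤ P.real A * μ :=
    mul_le_mul_of_nonneg_left hEH measureReal_nonneg
  linarith

end Concentration

/-! ### Stein discrepancy of one summand and the bound for measurable summands. -/

section Stein

variable {Ω : Type*} [MeasurableSpace Ω] {P : Measure Ω} [IsProbabilityMeasure P]

/-- By independence and Fubini, U can be integrated first with Y = y frozen, where `hconc` applies
with r = |y|. It is used for h = 1 and h(x) = x². -/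
theorem integral_mul_indicator_abs_sub_le {U Y : Ω → ℝ} (hU : Measurable U) (hY : Measurable Y)
    (hind : IndepFun U Y P) {h : ℝ → ℝ} (hm : Measurable h) (hnn : ∀ x, 0 ≤ h x)
    (hi : Integrable (fun ω => h (Y ω)) P) (hi' : Integrable (fun ω => h (Y ω) * |Y ω|) P)
    {γ z : ℝ} (hconc : ∀ r, 0 ≤ r → P.real {ω | |U ω - z| ≤ r} ≤ 2 * r + 4 * γ) :
    Integrable (fun ω => h (Y ω) * (if |U ω - z| ≤ |Y ω| then 1 else 0)) P ∧
    ∫ ω, h (Y ω) * (if |U ω - z| ≤ |Y ω| then 1 else 0) ∂P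
      ≤ 2 * ∫ ω, h (Y ω) * |Y ω| ∂P + 4 * γ * ∫ ω, h (Y ω) ∂P := by
  have habs : Measurable fun x : ℝ => |x| := continuous_abs.measurable
  set F : ℝ × ℝ → ℝ := fun p => h p.2 * (if |p.1 - z| ≤ |p.2| then 1 else 0) with hF
  have hset : MeasurableSet {p : ℝ × ℝ | |p.1 - z| ≤ |p.2|} :=
    measurableSet_le (habs.comp (measurable_fst.sub_const z)) (habs.comp measurable_snd)
  have hFm : Measurable F :=
    (hm.comp measurable_snd).mul (Measurable.ite hset measurable_const measurable_const)
  have hUY : Measurable fun ω => (U ω, Y ω) := hU.prodMk hY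
  have hFi : Integrable (fun ω => F (U ω, Y ω)) P := by
    refine hi.mono (hFm.comp hUY).aestronglyMeasurable (.of_forall fun ω => ?_)
    simp only [hF, norm_mul]
    refine mul_le_of_le_one_right (norm_nonneg _) ?_
    split_ifs <;> simp
  refine ⟨hFi, ?_⟩
  have hmap := (indepFun_iff_map_prod_eq_prod_map_map hU.aemeasurable hY.aemeasurable).1 hind
  have : IsProbabilityMeasure (P.map U) := Measure.isProbabilityMeasure_map hU.aemeasurable
  have : IsProbabilityMeasure (P.map Y) := Measure.isProbabilityMeasure_map hY.aemeasurable
  have hFi2 : Integrable F ((P.map U).prod (P.map Y)) := by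
    rw [← hmap]
    exact (integrable_map_measure hFm.aestronglyMeasurable hUY.aemeasurable).2 hFi
  have e1 : ∫ ω, F (U ω, Y ω) ∂P = ∫ y, ∫ u, F (u, y) ∂(P.map U) ∂(P.map Y) := by
    rw [← integral_map hUY.aemeasurable hFm.aestronglyMeasurable, hmap, integral_prod_symm _ hFi2]
  have e2 : ∫ y, ∫ u, F (u, y) ∂(P.map U) ∂(P.map Y)
      ≤ ∫ y, (2 * (h y * |y|) + 4 * γ * h y) ∂(P.map Y) := by
    refine integral_mono hFi2.integral_prod_right ?_ fun y => ?_
    · refine Integrable.add (Integrable.const_mul ?_ 2) (Integrable.const_mul ?_ _)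
      · exact (integrable_map_measure (hm.mul habs).aestronglyMeasurable hY.aemeasurable).2 hi'
      · exact (integrable_map_measure hm.aestronglyMeasurable hY.aemeasurable).2 hi
    · simp only [hF]
      rw [integral_const_mul]
      have hs : MeasurableSet {u : ℝ | |u - z| ≤ |y|} :=
        measurableSet_le (habs.comp (measurable_id.sub_const z)) measurable_const
      have e3 : ∫ u, (if |u - z| ≤ |y| then (1 : ℝ) else 0) ∂(P.map U)
          = P.real {ω | |U ω - z| ≤ |y|} := by
        have := integral_indicator_one (μ := P.map U) hs
        rw [map_measureReal_apply hU hs] at this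
        simpa [Set.indicator] using this
      rw [e3]
      have := mul_le_mul_of_nonneg_left (hconc |y| (abs_nonneg y)) (hnn y)
      linarith
  refine (e1.le.trans e2).trans_eq ?_
  have hr : Measurable fun y => 2 * (h y * |y|) + 4 * γ * h y :=
    ((hm.mul habs).const_mul 2).add (hm.const_mul (4 * γ))
  rw [integral_map hY.aemeasurable hr.aestronglyMeasurable,
    integral_add (hi'.const_mul 2) (hi.const_mul _), integral_const_mul, integral_const_mul]

/-- The contribution of a single summand `Y` to the Stein discrepancy of `U + Y`. -/
theorem abs_stein_discrepancy_le {U Y : Ω → ℝ} (hU : Measurable U) (hY : Measurable Y)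
    (hind : IndepFun U Y P) (h3 : Integrable (fun ω => |Y ω| ^ 3) P) (hUi : Integrable U P)
    (hU1 : ∫ ω, |U ω| ∂P ≤ 1) {γ z : ℝ}
    (hconc : ∀ r, 0 ≤ r → P.real {ω | |U ω - z| ≤ r} ≤ 2 * r + 4 * γ) :
    |(∫ ω, Y ω ^ 2 ∂P) * ∫ ω, steinDeriv z (U ω + Y ω) ∂P
        - ∫ ω, Y ω * (steinSol z (U ω + Y ω) - steinSol z (U ω)) ∂P|
      ≤ 18 * ∫ ω, |Y ω| ^ 3 ∂P + 20 * γ * ∫ ω, Y ω ^ 2 ∂P := by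
  have habs : Measurable fun x : ℝ => |x| := continuous_abs.measurable
  have h2 := memLp_two_of_integrable hY h3
  have h1 : Integrable Y P := h2.integrable (by norm_num)
  have hDi : ∀ V : Ω → ℝ, Measurable V → Integrable (fun ω => steinDeriv z (V ω)) P :=
    fun V hV => Integrable.of_bound
      ((measurable_steinDeriv z).comp hV).aestronglyMeasurable 2
      (.of_forall fun ω => abs_steinDeriv_le_two z _)
  have hDU := hDi U hU
  have hDUY := hDi (fun ω => U ω + Y ω) (hU.add hY)
  have hY2D : Integrable (fun ω => Y ω ^ 2 * steinDeriv z (U ω)) P :=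
    h2.integrable_sq.mul_bdd (c := 2) ((measurable_steinDeriv z).comp hU).aestronglyMeasurable
      (.of_forall fun ω => abs_steinDeriv_le_two z _)
  have hYf : Integrable (fun ω => Y ω * (steinSol z (U ω + Y ω) - steinSol z (U ω))) P := by
    refine h1.mul_bdd (c := 2 + 2) (((measurable_steinSol z).comp (hU.add hY)).sub
      ((measurable_steinSol z).comp hU)).aestronglyMeasurable (.of_forall fun ω => ?_)
    exact (norm_sub_le _ _).trans
      (add_le_add (abs_steinSol_le_two z _) (abs_steinSol_le_two z _))
  have hprod : ∫ ω, Y ω ^ 2 * steinDeriv z (U ω) ∂P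
      = (∫ ω, Y ω ^ 2 ∂P) * ∫ ω, steinDeriv z (U ω) ∂P :=
    (hind.symm.comp (measurable_id.pow_const 2)
      (measurable_steinDeriv z)).integral_fun_mul_eq_mul_integral
      (hY.pow_const 2).aestronglyMeasurable
      ((measurable_steinDeriv z).comp hU).aestronglyMeasurable
  have hgm : Measurable fun u : ℝ => 2 * |u| + 2 := (habs.const_mul 2).add_const 2
  have hgi : Integrable (fun ω => 2 * |U ω| + 2) P := (hUi.abs.const_mul 2).add (integrable_const 2)
  have hg4 : ∫ ω, (2 * |U ω| + 2) ∂P ≤ 4 := by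
    rw [integral_add (hUi.abs.const_mul 2) (integrable_const 2), integral_const_mul]
    simp only [integral_const, probReal_univ, smul_eq_mul, one_mul]
    linarith
  have hweight : ∀ q : ℝ → ℝ, Measurable q → (∀ x, 0 ≤ q x) → Integrable (fun ω => q (Y ω)) P →
      Integrable (fun ω => (2 * |U ω| + 2) * q (Y ω)) P ∧
      ∫ ω, (2 * |U ω| + 2) * q (Y ω) ∂P ≤ 4 * ∫ ω, q (Y ω) ∂P := fun q hq hq0 hqi => by
    have hc : IndepFun (fun ω => 2 * |U ω| + 2) (fun ω => q (Y ω)) P := hind.comp hgm hq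
    refine ⟨hc.integrable_mul hgi hqi, ?_⟩
    rw [hc.integral_fun_mul_eq_mul_integral hgi.aestronglyMeasurable hqi.aestronglyMeasurable]
    exact mul_le_mul_of_nonneg_right hg4 (integral_nonneg fun ω => hq0 _)
  obtain ⟨hw1, hw1'⟩ := hweight (fun x => |x|) habs abs_nonneg h1.abs
  obtain ⟨hw3, hw3'⟩ := hweight (fun x => |x| ^ 3) (habs.pow_const 3) (fun x => by positivity) h3
  obtain ⟨hj0, hj0'⟩ := integral_mul_indicator_abs_sub_le hU hY hind (h := fun _ => 1)
    measurable_const (fun _ => zero_le_one) (integrable_const 1) (by simpa using h1.abs) hconc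
  have e3 : ∀ x : ℝ, x ^ 2 * |x| = |x| ^ 3 := fun x => by rw [← sq_abs]; ring
  obtain ⟨hj2, hj2'⟩ := integral_mul_indicator_abs_sub_le hU hY hind (h := fun x => x ^ 2)
    (measurable_id.pow_const 2) sq_nonneg h2.integrable_sq (by simpa only [e3] using h3) hconc
  simp only [e3, one_mul, integral_const, probReal_univ, smul_eq_mul, mul_one]
    at hw1 hw1' hw3 hw3' hj0 hj0' hj2 hj2'
  -- The weight 2|U| + 2 contributes 4 E|Y|, the jump 2 E|Y| + 4γ.
  have hA : |∫ ω, steinDeriv z (U ω + Y ω) ∂P - ∫ ω, steinDeriv z (U ω) ∂P|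
      ≤ 6 * ∫ ω, |Y ω| ∂P + 4 * γ := by
    rw [← integral_sub hDUY hDU]
    refine (abs_integral_le_integral_abs).trans ((integral_mono (hDUY.sub hDU).abs
      (hw1.add hj0) fun ω => abs_steinDeriv_sub_le z (U ω) (Y ω)).trans ?_)
    rw [integral_add' hw1 hj0]
    linarith
  -- Here 12 = 4 + 4·2 and 16 = 4·4, the jump entering with factor 4|Y|.
  have hB : |∫ ω, Y ω * (steinSol z (U ω + Y ω) - steinSol z (U ω)) ∂P
        - ∫ ω, Y ω ^ 2 * steinDeriv z (U ω) ∂P|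
      ≤ 12 * ∫ ω, |Y ω| ^ 3 ∂P + 16 * γ * ∫ ω, Y ω ^ 2 ∂P := by
    rw [← integral_sub hYf hY2D]
    refine (abs_integral_le_integral_abs).trans ((integral_mono (hYf.sub hY2D).abs
      (hw3.add (hj2.const_mul 4)) fun ω => ?_).trans ?_)
    · have := mul_le_mul_of_nonneg_left (abs_steinSol_taylor_le z (U ω) (Y ω)) (abs_nonneg (Y ω))
      rw [← abs_mul] at this
      simp only [Pi.add_apply, Pi.sub_apply]
      calc _ = |Y ω * (steinSol z (U ω + Y ω) - steinSol z (U ω)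
              - Y ω * steinDeriv z (U ω))| := by congr 1; ring
        _ ≤ _ := this
        _ = _ := by rw [← sq_abs (Y ω)]; ring
    · rw [integral_add' hw3 (hj2.const_mul 4), integral_const_mul]
      linarith
  rw [hprod] at hB
  have hσ : 0 ≤ ∫ ω, Y ω ^ 2 ∂P := integral_nonneg fun ω => sq_nonneg _
  have hA' := mul_le_mul_of_nonneg_left hA hσ
  have hm := integral_sq_mul_integral_abs_le hY h3
  rw [← abs_of_nonneg hσ, ← abs_mul, abs_of_nonneg hσ] at hA'
  rw [abs_le] at hA' hB ⊢
  constructor <;> nlinarith [hA'.1, hA'.2, hB.1, hB.2]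

/-- The Berry–Esseen bound for measurable summands, against the explicit Gaussian distribution
function. -/
theorem abs_measureReal_sum_le_sub_gaussCDF_le {ι : Type*} [Fintype ι] [DecidableEq ι]
    {X : ι → Ω → ℝ} (hX : ∀ k, Measurable (X k)) (hi : iIndepFun X P)
    (h3 : ∀ k, Integrable (fun ω => |X k ω| ^ 3) P) (h0 : ∀ k, ∫ ω, X k ω ∂P = 0)
    (hvar : variance (fun ω => ∑ k, X k ω) P = 1) (z : ℝ) :
    |P.real {ω | ∑ k, X k ω ≤ z} - gaussCDF z| ≤ 38 * ∑ k, ∫ ω, |X k ω| ^ 3 ∂P := by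
  have h2 : ∀ k, MemLp (X k) 2 P := fun k => memLp_two_of_integrable (hX k) (h3 k)
  have hS : Measurable fun ω => ∑ j, X j ω := Finset.measurable_fun_sum _ fun j _ => hX j
  set γ := ∑ k, ∫ ω, |X k ω| ^ 3 ∂P with hγdef
  have hβ : ∀ k, 0 ≤ ∫ ω, |X k ω| ^ 3 ∂P := fun k => integral_nonneg fun ω => by positivity
  have hβγ : ∀ k, ∫ ω, |X k ω| ^ 3 ∂P ≤ γ := fun k =>
    Finset.single_le_sum (fun k _ => hβ k) (Finset.mem_univ k)
  have hσ : ∀ k, 0 ≤ ∫ ω, X k ω ^ 2 ∂P := fun k => integral_nonneg fun ω => sq_nonneg _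
  rw [variance_finset_sum_eq hi _ h2 h0] at hvar
  -- For γ ≥ 1/8 the bound exceeds 1 and is trivial. For γ < 1/8 each σ_k is at most 1/2, so
  -- deleting one summand leaves the variance 3/4 needed for concentration.
  rcases le_or_gt (1 / 8) γ with hγ8 | hγ8
  · have p0 : 0 ≤ P.real {ω | ∑ k, X k ω ≤ z} := measureReal_nonneg
    have p1 : P.real {ω | ∑ k, X k ω ≤ z} ≤ 1 := measureReal_le_one
    have c0 := gaussCDF_nonneg z
    have c1 := gaussCDF_le_one z
    rw [abs_le]
    constructor <;> linarith
  have hσ4 : ∀ k, ∫ ω, X k ω ^ 2 ∂P ≤ 1 / 4 := fun k => by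
    have h := ((sqrt_integral_sq_pow_three_le (hX k) (h3 k)).trans (hβγ k)).trans hγ8.le
    rw [show (1 / 8 : ℝ) = (1 / 2) ^ 3 by norm_num] at h
    have := le_of_pow_le_pow_left₀ (by norm_num) (by norm_num) h
    rw [Real.sqrt_le_left (by norm_num)] at this
    linarith
  have hγ : 0 < γ := by
    refine lt_of_le_of_ne (Finset.sum_nonneg fun k _ => hβ k) fun h => ?_
    have hz : ∀ k, ∫ ω, X k ω ^ 2 ∂P = 0 := fun k => by
      have h := (sqrt_integral_sq_pow_three_le (hX k) (h3 k)).trans ((hβγ k).trans h.ge)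
      have h' := pow_eq_zero_iff (by norm_num) |>.1
        (le_antisymm h (pow_nonneg (Real.sqrt_nonneg _) 3))
      exact (Real.sqrt_eq_zero (hσ k)).1 h'
    simp [hz] at hvar
  have herase : ∀ k, ∑ j ∈ Finset.univ.erase k, ∫ ω, X j ω ^ 2 ∂P
      = 1 - ∫ ω, X k ω ^ 2 ∂P := fun k => by
    rw [← hvar, ← Finset.add_sum_erase _ _ (Finset.mem_univ k)]
    ring
  have hterm : ∀ k, |(∫ ω, X k ω ^ 2 ∂P) * ∫ ω, steinDeriv z (∑ j, X j ω) ∂P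
        - ∫ ω, X k ω * (steinSol z (∑ j, X j ω) - steinSol z (∑ j, X j ω - X k ω)) ∂P|
      ≤ 18 * ∫ ω, |X k ω| ^ 3 ∂P + 20 * γ * ∫ ω, X k ω ^ 2 ∂P := fun k => by
    have hUm : Measurable fun ω => ∑ j ∈ Finset.univ.erase k, X j ω :=
      Finset.measurable_fun_sum _ fun j _ => hX j
    have hU2 : MemLp (fun ω => ∑ j ∈ Finset.univ.erase k, X j ω) 2 P :=
      memLp_finsetSum _ fun j _ => h2 j
    have hU1 := integral_abs_le_of_integral_sq_le hU2 one_pos (by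
      rw [integral_finset_sum_sq_eq hi _ h2 h0, herase]
      linarith [hσ k])
    have := abs_stein_discrepancy_le hUm (hX k) (indepFun_sum_erase hX hi _ k) (h3 k)
      (hU2.integrable (by norm_num)) hU1 (γ := γ) (z := z) fun r hr => by
        have := concentration_sum_le hX hi h3 h0 (Finset.univ.erase k) hγ
          (Finset.sum_le_sum_of_subset_of_nonneg (Finset.erase_subset _ _) fun j _ _ => hβ j)
          (by rw [herase]; linarith [hσ k]) (by rw [herase]; linarith [hσ4 k])
          (show z - r ≤ z + r by linarith)
        have e : {ω | |∑ j ∈ Finset.univ.erase k, X j ω - z| ≤ r}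
            = {ω | ∑ j ∈ Finset.univ.erase k, X j ω ∈ Set.Icc (z - r) (z + r)} := by
          ext ω
          simp only [Set.mem_ofPred_eq, Set.mem_Icc, abs_le]
          constructor <;> rintro ⟨_, _⟩ <;> constructor <;> linarith
        rw [e]
        linarith
    simp only [Finset.sum_erase_add _ _ (Finset.mem_univ k)] at this
    have e : ∀ ω, ∑ j, X j ω - X k ω = ∑ j ∈ Finset.univ.erase k, X j ω := fun ω => by
      rw [← Finset.add_sum_erase _ (fun j => X j ω) (Finset.mem_univ k)]; ring
    simp only [e]
    exact this
  have hSm : MeasurableSet {ω | ∑ k, X k ω ≤ z} := hS measurableSet_Iic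
  have hf : Measurable fun ω => (∑ k, X k ω) * steinSol z (∑ k, X k ω) :=
    hS.mul ((measurable_steinSol z).comp hS)
  have hfi : Integrable (fun ω => (∑ k, X k ω) * steinSol z (∑ k, X k ω)) P :=
    Integrable.of_bound hf.aestronglyMeasurable 1
      (.of_forall fun ω => abs_mul_steinSol_le_one z _)
  have hI : Integrable ({ω | ∑ k, X k ω ≤ z}.indicator (1 : Ω → ℝ)) P :=
    (integrable_const (1 : ℝ)).indicator hSm
  have hD : ∫ ω, steinDeriv z (∑ k, X k ω) ∂P
      = ∫ ω, (∑ k, X k ω) * steinSol z (∑ k, X k ω) ∂P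
        + P.real {ω | ∑ k, X k ω ≤ z} - gaussCDF z := by
    rw [← integral_indicator_one hSm, ← integral_add' hfi hI]
    have : ∫ _, gaussCDF z ∂P = gaussCDF z := by simp
    rw [← this, ← integral_sub (hfi.add hI) (integrable_const _)]
    refine integral_congr_ae (.of_forall fun ω => ?_)
    simp [steinDeriv, Set.indicator]
  have hsum := integral_sum_mul_eq hX hi h2 h0 Finset.univ (measurable_steinSol z)
    (abs_steinSol_le_two z)
  -- The weights σ_k² sum to 1, which distributes E f'(S) over the summands.
  have key : P.real {ω | ∑ k, X k ω ≤ z} - gaussCDF z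
      = ∑ k, ((∫ ω, X k ω ^ 2 ∂P) * ∫ ω, steinDeriv z (∑ j, X j ω) ∂P
        - ∫ ω, X k ω * (steinSol z (∑ j, X j ω) - steinSol z (∑ j, X j ω - X k ω)) ∂P) := by
    rw [Finset.sum_sub_distrib, ← Finset.sum_mul, hvar, ← hsum, hD]
    ring
  rw [key]
  refine (Finset.abs_sum_le_sum_abs _ _).trans ((Finset.sum_le_sum fun k _ => hterm k).trans ?_)
  rw [Finset.sum_add_distrib, ← Finset.mul_sum, ← Finset.mul_sum, hvar]
  linarith

end Stein

/-! ### Reduction to measurable summands. -/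

theorem theorem1 :
    ∃ C : ℝ, 0 < C ∧
      ∀ {Ω : Type*} [MeasurableSpace Ω] (P : Measure Ω) [IsProbabilityMeasure P]
        {Ω' : Type*} [MeasurableSpace Ω'] (P' : Measure Ω') [IsProbabilityMeasure P']
        (n : ℕ) (X : Fin n → Ω → ℝ) (G : Ω' → ℝ),
        (∀ k, AEMeasurable (X k) P) →
        iIndepFun X P →
        (∀ k, Integrable (fun ω => |X k ω| ^ 3) P) →
        (∀ k, ∫ ω, X k ω ∂P = 0) →
        variance (fun ω => ∑ k, X k ω) P = 1 →
        HasLaw G (gaussianReal 0 1) P' →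
        ⨆ a : ℝ, |P.real {ω | ∑ k, X k ω ≤ a} - P'.real {ω | G ω ≤ a}|
          ≤ C * ∑ k, ∫ ω, |X k ω| ^ 3 ∂P := by
  refine ⟨38, by norm_num, ?_⟩
  intro Ω _ P _ Ω' _ P' _ n X G hX hi h3 h0 hvar hG
  -- `Real.iSup_le` also asks for a nonnegative bound, because real suprema default to 0.
  refine Real.iSup_le (fun a => ?_) (mul_nonneg (by norm_num)
    (Finset.sum_nonneg fun k _ => integral_nonneg fun ω => by positivity))
  have hGa : P'.real {ω | G ω ≤ a} = gaussCDF a := by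
    rw [hG.measureReal_eq (p := fun x => x ≤ a) measurableSet_Iic]
    exact gaussianReal_real_Iic a
  have hk : ∀ k, X k =ᵐ[P] (hX k).mk (X k) := fun k => (hX k).ae_eq_mk
  have hall : ∀ᵐ ω ∂P, ∀ k, X k ω = (hX k).mk (X k) ω := ae_all_iff.2 hk
  have hsum : (fun ω => ∑ k, X k ω) =ᵐ[P] fun ω => ∑ k, (hX k).mk (X k) ω := by
    filter_upwards [hall] with ω hω
    exact Finset.sum_congr rfl fun k _ => hω k
  have hset : P.real {ω | ∑ k, X k ω ≤ a} = P.real {ω | ∑ k, (hX k).mk (X k) ω ≤ a} := by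
    refine measureReal_congr ?_
    filter_upwards [hsum] with ω hω
    exact congrArg (· ≤ a) hω
  have h3k : ∀ k, (fun ω => |X k ω| ^ 3) =ᵐ[P] fun ω => |(hX k).mk (X k) ω| ^ 3 := fun k => by
    filter_upwards [hk k] with ω hω
    rw [hω]
  rw [hGa, hset]
  simp only [fun k => integral_congr_ae (h3k k)]
  refine abs_measureReal_sum_le_sub_gaussCDF_le (fun k => (hX k).measurable_mk) (hi.congr hk)
    (fun k => (h3 k).congr (h3k k)) (fun k => ?_) ?_ a
  · rw [← integral_congr_ae (hk k)]
    exact h0 k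
  · rw [← variance_congr hsum]
    exact hvar
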